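/- A \emph{relative category} is a pair $(\mathbb{C},V)$ of a small category $\mathbb{C}$ and a wide subcategory $V\subseteq\mathbb{C}$ of weak equivalences; relative functors are functors preserving weak equivalences, and $\mathrm{RelCat}$ is the resulting category. For a relative poset $P$, let $\xi_tP$ (resp. $\xi_iP$) be the poset of nonempty finite chains of $P$ ordered by inclusion (resp. reverse inclusion), where $A\le B$ is a weak equivalence if $\max A\to\max B$ (resp. $\min A\to\min B$) is one in $P$; put $\xi=\xi_t\xi_i$. Let $K_\xi\colon s\mathbf{S}\to\mathrm{RelCat}$ be the left Kan extension along the Yoneda embedding of $\Delta[m,n]\mapsto\xi([m]^{\vee}\times[n]^{\wedge})$, where $[m]^{\vee}$ is $[m]$ with only identities as weak equivalences, $[n]^{\wedge}$ is $[n]$ with all maps as weak equivalences, and $s\mathbf{S}$ is the category of bisimplicial sets. The Barwick--Kan model structure on $\mathrm{RelCat}$ is the one transferred along $K_\xi$ from the Reedy model structure on $s\mathbf{S}$; it is cofibrantly generated, with generating cofibrations $K_\xi(\delta_m\,\Box'\,\delta_n)$ for $m,n\ge 0$, where $\Box'$ is the pushout-product of the box product $(A\Box B)_{m,n}=A_m\times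 B_n$ and $\delta_k\colon\partial\Delta^k\hookrightarrow\Delta^k$ is the boundary inclusion. That is, its cofibrations are the maps having the left lifting property against all maps that have the right lifting property against every $K_\xi(\delta_m\,\Box'\,\delta_n)$. \textbf{Proposition.} Let $(\mathbb{C},V)$ be a cofibrant object in the Barwick--Kan model structure on $\mathrm{RelCat}$, i.e. the map $\emptyset\to(\mathbb{C},V)$ is a cofibration. Then the underlying category $\mathbb{C}$ is a direct (i.e. well-founded) poset: there is at most one morphism between any two objects, two objects with morphisms in both directions are equal, and the strict order ($x<y$ iff $x\neq y$ and there is a morphism $x\to y$) is well-founded. -/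

import Mathlib

open CategoryTheory Limits Opposite
open PartialOrder (NonemptyFiniteChains)

universe u

/-- A small relative category: a small category together with a wide subcategory, whose morphisms
are called the weak equivalences. -/
structure RelativeCat : Type (u + 1) where
  carrier : Type u
  [category : SmallCategory carrier]
  weq : MorphismProperty carrier
  [isMultiplicative : weq.IsMultiplicative]

namespace RelativeCat

instance : CoeSort RelativeCat.{u} (Type u) := ⟨RelativeCat.carrier⟩

instance (X : RelativeCat.{u}) : SmallCategory X := X.category

instance (X : RelativeCat.{u}) : X.weq.IsMultiplicative := X.isMultiplicative

/-- Relative functors: functors that preserve weak equivalences. -/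
@[ext]
structure Hom (X Y : RelativeCat.{u}) where
  functor : X ⥤ Y
  map_weq : X.weq ≤ Y.weq.inverseImage functor

instance : Category.{u} RelativeCat.{u} where
  Hom := Hom
  id X := { functor := 𝟭 X, map_weq := fun _ _ _ h => h }
  comp F G :=
    { functor := F.functor ⋙ G.functor
      map_weq := fun _ _ f h => G.map_weq _ (F.map_weq f h) }

@[ext]
lemma hom_ext {X Y : RelativeCat.{u}} {F G : X ⟶ Y} (h : F.functor = G.functor) : F = G :=
  Hom.ext h

/-- The functor sending a relative category to its underlying category. -/
@[simps]
def toCat : RelativeCat.{u} ⥤ Cat.{u, u} where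
  obj X := Cat.of X
  map F := F.functor.toCatHom

section Colimits

/-! Colimits of relative categories: the colimit of the underlying categories, the weak
equivalences being generated under composition by the images of the given ones. -/

variable {J : Type u} [SmallCategory J] (F : J ⥤ RelativeCat.{u})

/-- The images of the weak equivalences in the colimit of the underlying categories. -/
inductive ColimGen : MorphismProperty ↑(colimit (F ⋙ toCat))
  | mk (j : J) {x y : F.obj j} (f : x ⟶ y) (hf : (F.obj j).weq f) :
      ColimGen ((colimit.ι (F ⋙ toCat) j).toFunctor.map f)

/-- The colimit of a diagram of relative categories. -/
noncomputable def colim : RelativeCat.{u} where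
  carrier := (colimit (F ⋙ toCat) : Cat.{u, u})
  weq := (ColimGen F).multiplicativeClosure

/-- The colimit cocone of a diagram of relative categories. -/
noncomputable def colimCocone : Cocone F where
  pt := colim F
  ι :=
    { app := fun j =>
        { functor := (colimit.ι (F ⋙ toCat) j).toFunctor
          map_weq := fun _ _ f hf =>
            MorphismProperty.multiplicativeClosure.of _ (ColimGen.mk j f hf) }
      naturality := fun j k f => by
        ext1
        have h := congrArg Cat.Hom.toFunctor (colimit.w (F ⋙ toCat) f)
        exact h }

/-- The functor induced by a cocone on the colimit of the underlying categories. -/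
noncomputable def colimDesc (s : Cocone F) : colim F ⥤ s.pt :=
  (colimit.desc (F ⋙ toCat) (toCat.mapCocone s)).toFunctor

lemma colim_fac (s : Cocone F) (j : J) :
    ((colimCocone F).ι.app j).functor ⋙ colimDesc F s = (s.ι.app j).functor :=
  congrArg Cat.Hom.toFunctor (colimit.ι_desc (toCat.mapCocone s) j)

lemma colimDesc_map_weq (s : Cocone F) :
    (colim F).weq ≤ s.pt.weq.inverseImage (colimDesc F s) := by
  have gen : ∀ {x y : colim F} (f : x ⟶ y), ColimGen F f →
      s.pt.weq ((colimDesc F s).map f) := by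
    rintro _ _ _ ⟨j, g, hg⟩
    have key : s.pt.weq ((((colimCocone F).ι.app j).functor ⋙ colimDesc F s).map g) := by
      rw [colim_fac]
      exact (s.ι.app j).map_weq g hg
    exact key
  intro x y f hf
  change s.pt.weq ((colimDesc F s).map f)
  change (ColimGen F).multiplicativeClosure f at hf
  induction hf with
  | of f hf => exact gen f hf
  | id x =>
    have h : (colimDesc F s).map (𝟙 x) = 𝟙 ((colimDesc F s).obj x) := (colimDesc F s).map_id x
    exact h ▸ s.pt.weq.id_mem _
  | comp_of f g _ hg ih =>
    have h : (colimDesc F s).map (f ≫ g) = (colimDesc F s).map f ≫ (colimDesc F s).map g :=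
      (colimDesc F s).map_comp f g
    exact h ▸ s.pt.weq.comp_mem _ _ ih (gen g hg)

/-- The universal property of the colimit. -/
noncomputable def colimCoconeIsColimit : IsColimit (colimCocone F) where
  desc s := { functor := colimDesc F s, map_weq := colimDesc_map_weq F s }
  fac s j := by
    ext1
    exact colim_fac F s j
  uniq s m hm := by
    ext1
    have h : (Cat.Hom.ofFunctor m.functor : colimit (F ⋙ toCat) ⟶ Cat.of s.pt) =
        colimit.desc (F ⋙ toCat) (toCat.mapCocone s) := by
      refine colimit.hom_ext (F := F ⋙ toCat) fun j => ?_
      exact (congrArg toCat.map (hm j)).trans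
        (colimit.ι_desc (F := F ⋙ toCat) (toCat.mapCocone s) j).symm
    exact congrArg Cat.Hom.toFunctor h

instance : HasColimits RelativeCat.{u} where
  has_colimits_of_shape _ _ :=
    { has_colimit := fun F => ⟨⟨⟨colimCocone F, colimCoconeIsColimit F⟩⟩⟩ }

instance : HasColimitsOfSize.{0, u} RelativeCat.{u} := hasColimitsOfSizeShrink.{0, u, u, u} _

end Colimits

end RelativeCat

/-- A relative poset: a poset with a reflexive and transitive relation contained in its order,
i.e. a relative category whose underlying category is a poset. -/
structure RelPoset : Type (u + 1) where
  carrier : Type u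
  [partialOrder : PartialOrder carrier]
  weq : carrier → carrier → Prop
  le_of_weq {x y : carrier} : weq x y → x ≤ y
  weq_refl (x : carrier) : weq x x
  weq_trans {x y z : carrier} : weq x y → weq y z → weq x z

namespace RelPoset

instance : CoeSort RelPoset.{u} (Type u) := ⟨RelPoset.carrier⟩

instance (P : RelPoset.{u}) : PartialOrder P := P.partialOrder

/-- Relative functors between relative posets. -/
@[ext]
structure Hom (P Q : RelPoset.{u}) where
  toOrderHom : P →o Q
  map_weq {x y : P} : P.weq x y → Q.weq (toOrderHom x) (toOrderHom y)

instance : Category.{u} RelPoset.{u} where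
  Hom := Hom
  id P := { toOrderHom := OrderHom.id, map_weq := fun h => h }
  comp f g :=
    { toOrderHom := g.toOrderHom.comp f.toOrderHom
      map_weq := fun h => g.map_weq (f.map_weq h) }

@[ext]
lemma hom_ext {P Q : RelPoset.{u}} {f g : P ⟶ Q} (h : f.toOrderHom = g.toOrderHom) : f = g :=
  Hom.ext h

/-- A relative poset, seen as a relative category. -/
def toRelativeCat : RelPoset.{u} ⥤ RelativeCat.{u} where
  obj P :=
    { carrier := P
      weq := fun x y _ => P.weq x y
      isMultiplicative :=
        { id_mem := fun x => P.weq_refl x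
          comp_mem := fun _ _ h h' => P.weq_trans h h' } }
  map f :=
    { functor := f.toOrderHom.monotone.functor
      map_weq := fun _ _ _ h => f.map_weq h }

lemma exists_isGreatest {X : Type*} [PartialOrder X] (A : NonemptyFiniteChains X) :
    ∃ a, IsGreatest (A.finset : Set X) a := by
  obtain ⟨a, ha⟩ := A.finset.exists_maximal A.nonempty
  refine ⟨a, ha.1, fun b hb => ?_⟩
  rcases A.comparable ⟨a, ha.1⟩ ⟨b, hb⟩ with h | h
  · exact ha.2 hb h
  · exact h

lemma exists_isLeast {X : Type*} [PartialOrder X] (A : NonemptyFiniteChains X) :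
    ∃ a, IsLeast (A.finset : Set X) a := by
  obtain ⟨a, ha⟩ := A.finset.exists_minimal A.nonempty
  refine ⟨a, ha.1, fun b hb => ?_⟩
  rcases A.comparable ⟨a, ha.1⟩ ⟨b, hb⟩ with h | h
  · exact h
  · exact ha.2 hb h

lemma isGreatest_map {X Y : Type*} [PartialOrder X] [PartialOrder Y]
    {A : NonemptyFiniteChains X} {a : X} (h : IsGreatest (A.finset : Set X) a) (f : X →o Y) :
    IsGreatest ((A.map f).finset : Set Y) (f a) := by
  refine ⟨by simpa using ⟨a, h.1, rfl⟩, fun b hb => ?_⟩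
  obtain ⟨c, hc, rfl⟩ := (PartialOrder.NonemptyFiniteChains.mem_map_iff A f b).1 hb
  exact f.monotone (h.2 hc)

lemma isLeast_map {X Y : Type*} [PartialOrder X] [PartialOrder Y]
    {A : NonemptyFiniteChains X} {a : X} (h : IsLeast (A.finset : Set X) a) (f : X →o Y) :
    IsLeast ((A.map f).finset : Set Y) (f a) := by
  refine ⟨by simpa using ⟨a, h.1, rfl⟩, fun b hb => ?_⟩
  obtain ⟨c, hc, rfl⟩ := (PartialOrder.NonemptyFiniteChains.mem_map_iff A f b).1 hb
  exact f.monotone (h.2 hc)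

lemma map_id {X : Type*} [PartialOrder X] (A : NonemptyFiniteChains X) :
    A.map OrderHom.id = A := by
  ext x
  simp

lemma map_comp {X Y Z : Type*} [PartialOrder X] [PartialOrder Y] [PartialOrder Z]
    (A : NonemptyFiniteChains X) (f : X →o Y) (g : Y →o Z) :
    A.map (g.comp f) = (A.map f).map g := by
  ext x
  simp

/-- The terminal subdivision `ξ_t P`: its elements are the monomorphisms `[n] → P`
(`x₀ < ... < xₙ`), identified with the nonempty finite chains in `P`; these are ordered by
inclusion, and `A ≤ B` is a weak equivalence when the induced map between
the last elements of `A` and `B` is one in `P`. -/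
noncomputable def xiT : RelPoset.{u} ⥤ RelPoset.{u} where
  obj P :=
    { carrier := NonemptyFiniteChains P
      weq := fun A B => A ≤ B ∧ ∃ a b, IsGreatest (A.finset : Set P) a ∧
        IsGreatest (B.finset : Set P) b ∧ P.weq a b
      le_of_weq := fun h => h.1
      weq_refl := fun A => by
        obtain ⟨a, ha⟩ := exists_isGreatest A
        exact ⟨le_rfl, a, a, ha, ha, P.weq_refl a⟩
      weq_trans := by
        rintro A B C ⟨h, a, b, ha, hb, w⟩ ⟨h', b', c, hb', hc, w'⟩
        obtain rfl := hb.unique hb'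
        exact ⟨h.trans h', a, c, ha, hc, P.weq_trans w w'⟩ }
  map f :=
    { toOrderHom := PartialOrder.NonemptyFiniteChains.orderHomMap f.toOrderHom
      map_weq := by
        rintro A B ⟨h, a, b, ha, hb, w⟩
        exact ⟨(PartialOrder.NonemptyFiniteChains.orderHomMap f.toOrderHom).monotone h, _, _,
          isGreatest_map ha _, isGreatest_map hb _, f.map_weq w⟩ }
  map_id P := by
    ext A : 3
    exact map_id A
  map_comp f g := by
    ext A : 3
    exact map_comp A f.toOrderHom g.toOrderHom

/-- The initial subdivision `ξ_i P`: its elements are the nonempty finite chains in `P`, ordered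
by reverse inclusion, and `A ≤ B` (i.e. `B ⊆ A`) is a weak equivalence when the induced map from
the first element of `A` to the first element of `B` is one in `P`. -/
noncomputable def xiI : RelPoset.{u} ⥤ RelPoset.{u} where
  obj P :=
    { carrier := (NonemptyFiniteChains P)ᵒᵈ
      weq := fun A B => A ≤ B ∧ ∃ a b, IsLeast ((OrderDual.ofDual A).finset : Set P) a ∧
        IsLeast ((OrderDual.ofDual B).finset : Set P) b ∧ P.weq a b
      le_of_weq := fun h => h.1
      weq_refl := fun A => by
        obtain ⟨a, ha⟩ := exists_isLeast (OrderDual.ofDual A)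
        exact ⟨le_rfl, a, a, ha, ha, P.weq_refl a⟩
      weq_trans := by
        rintro A B C ⟨h, a, b, ha, hb, w⟩ ⟨h', b', c, hb', hc, w'⟩
        obtain rfl := hb.unique hb'
        exact ⟨h.trans h', a, c, ha, hc, P.weq_trans w w'⟩ }
  map f :=
    { toOrderHom := (PartialOrder.NonemptyFiniteChains.orderHomMap f.toOrderHom).dual
      map_weq := by
        rintro A B ⟨h, a, b, ha, hb, w⟩
        exact ⟨(PartialOrder.NonemptyFiniteChains.orderHomMap f.toOrderHom).dual.monotone h, _, _,
          isLeast_map ha _, isLeast_map hb _, f.map_weq w⟩ }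
  map_id P := by
    ext A : 3
    exact map_id (OrderDual.ofDual A)
  map_comp f g := by
    ext A : 3
    exact map_comp (OrderDual.ofDual A) f.toOrderHom g.toOrderHom

/-- The two-fold subdivision `ξ = ξ_t ξ_i`. -/
noncomputable def xi : RelPoset.{u} ⥤ RelPoset.{u} := xiI ⋙ xiT

/-- The functor `([m], [n]) ↦ [m]ˇ × [n]^`, the product of the minimal relative category on `[m]`
and the maximal relative category on `[n]`: the underlying poset is `[m] × [n]` and
`(i, j) ≤ (i', j')` is a weak equivalence when `i = i'`. -/
def grid : SimplexCategory × SimplexCategory ⥤ RelPoset.{u} where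
  obj p :=
    { carrier := ULift.{u} (Fin (p.1.len + 1) × Fin (p.2.len + 1))
      weq := fun x y => x.down.1 = y.down.1 ∧ x.down.2 ≤ y.down.2
      le_of_weq := fun h => ULift.down_le.1 (Prod.le_def.2 ⟨h.1.le, h.2⟩)
      weq_refl := fun _ => ⟨rfl, le_rfl⟩
      weq_trans := fun h h' => ⟨h.1.trans h'.1, h.2.trans h'.2⟩ }
  map f :=
    { toOrderHom :=
        { toFun := fun x => ⟨f.1.toOrderHom x.down.1, f.2.toOrderHom x.down.2⟩
          monotone' := fun _ _ h =>
            ⟨f.1.toOrderHom.monotone h.1, f.2.toOrderHom.monotone h.2⟩ }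
      map_weq := fun h =>
        ⟨congrArg f.1.toOrderHom h.1, f.2.toOrderHom.monotone h.2⟩ }

end RelPoset

/-- Bisimplicial sets. -/
abbrev BiSSet : Type (u + 1) := (SimplexCategory × SimplexCategory)ᵒᵖ ⥤ Type u

namespace BiSSet

/-- The box product `A □ B` of two simplicial sets: `(A □ B)_{m,n} = A_m × B_n`. -/
def box : SSet.{u} ⥤ SSet.{u} ⥤ BiSSet.{u} where
  obj A :=
    { obj := fun B =>
        { obj := fun p => A.obj (op p.unop.1) × B.obj (op p.unop.2)
          map := fun f => ↾fun x => (A.map f.unop.1.op x.1, B.map f.unop.2.op x.2)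
          map_id := fun p => by ext x <;> simp
          map_comp := fun f g => by ext x <;> simp }
      map := fun g =>
        { app := fun p => ↾fun x => (x.1, g.app (op p.unop.2) x.2)
          naturality := fun p q f => by
            ext x
            · rfl
            · exact NatTrans.naturality_apply g f.unop.2.op x.2 } }
  map f :=
    { app := fun B =>
        { app := fun p => ↾fun x => (f.app (op p.unop.1) x.1, x.2)
          naturality := fun p q g => by
            ext x
            · exact NatTrans.naturality_apply f g.unop.1.op x.1
            · rfl } }

/-- The set `I_v` of the pushout-products `δ_m □' δ_n` of boundary inclusions
`δ_k : ∂Δ[k] ⟶ Δ[k]`, for all `m` and `n`. -/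
noncomputable def generatingCofibrations : MorphismProperty BiSSet.{u} :=
  MorphismProperty.ofHoms fun p : ℕ × ℕ =>
    (Functor.PushoutObjObj.ofHasPushout box.{u}
      (SSet.boundary.{u} p.1).ι (SSet.boundary.{u} p.2).ι).ι

end BiSSet

namespace RelativeCat

/-- The functor `([m], [n]) ↦ ξ([m]ˇ × [n]^)`. -/
noncomputable def xiGrid : SimplexCategory × SimplexCategory ⥤ RelativeCat.{u} :=
  RelPoset.grid ⋙ RelPoset.xi ⋙ RelPoset.toRelativeCat

/-- The functor `K_ξ`, the left Kan extension of `([m], [n]) ↦ ξ([m]ˇ × [n]^)` along the Yoneda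
embedding. -/
noncomputable def K : BiSSet.{u} ⥤ RelativeCat.{u} :=
  (uliftYoneda.{u} : SimplexCategory × SimplexCategory ⥤ BiSSet.{u}).leftKanExtension xiGrid.{u}

/-- The nerve `N_ξ`, with `(N_ξ X)_{m,n}` the set of relative functors `ξ([m]ˇ × [n]^) ⟶ X`. -/
noncomputable def N : RelativeCat.{u} ⥤ BiSSet.{u} :=
  Presheaf.restrictedULiftYoneda.{0} xiGrid.{u}

/-- The adjunction between `K_ξ` and `N_ξ`. -/
noncomputable def adjunctionKN : K.{u} ⊣ N.{u} :=
  Presheaf.uliftYonedaAdjunction.{0}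
    ((uliftYoneda.{u} : SimplexCategory × SimplexCategory ⥤ BiSSet.{u}).leftKanExtension
      xiGrid.{u})
    ((uliftYoneda.{u} : SimplexCategory × SimplexCategory ⥤ BiSSet.{u}).leftKanExtensionUnit
      xiGrid.{u})

/-- The set `K_ξ[I_v]` of generating cofibrations of the Barwick–Kan model structure. -/
noncomputable def generatingCofibrations : MorphismProperty RelativeCat.{u} :=
  BiSSet.generatingCofibrations.{u}.map K.{u}

/-- The cofibrations of the Barwick–Kan model structure, which is cofibrantly generated by
`K_ξ[I_v]`: the morphisms with the left lifting property against all morphisms that have the right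
lifting property against `K_ξ[I_v]`. -/
noncomputable instance : HomotopicalAlgebra.CategoryWithCofibrations RelativeCat.{u} where
  cofibrations := generatingCofibrations.{u}.rlp.llp

end RelativeCat

/-- A category is a direct poset if there is at most one morphism between any two objects, distinct
objects do not admit morphisms in both directions, and the resulting strict order is
well-founded. -/
structure IsDirectPoset (C : Type*) [Category C] : Prop where
  subsingleton_hom (x y : C) : Subsingleton (x ⟶ y)
  antisymm (x y : C) : (x ⟶ y) → (y ⟶ x) → x = y
  wellFounded : WellFounded fun x y : C => x ≠ y ∧ Nonempty (x ⟶ y)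

/-! If `E ⟶ X` has the right lifting property against the generating cofibrations and `X` is
cofibrant, then `𝟙 X` lifts, so `X` is a retract of `E`; direct posets are stable under retracts
(`IsDirectPoset.of_retract`). It therefore suffices to find, over an arbitrary `X`, such a map whose
source is a direct poset.

Instead of a transfinite small object argument, `cellComplex` attaches all cells at once by an
inductive type: a point is a copy of some `b` in a cell `B i` over `X`, attached along a functor `f`
from a sieve `A i` to points already built. The sieve is a Dwyer sieve: an element of the cell above
a member of the sieve has a coreflection in it. Hence a point lies below the new copy of `b` either
inside the same cell, or because it lies below `f r` for the unique coreflection `r` of `b`. Arrows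
are thus determined by their endpoints, and the ordinal `depth` rises strictly on passing from an
attached point to the cell, which gives antisymmetry and well-foundedness. Since `X` is not known to
be a poset, each arrow records the morphism of `X` beneath it. A lifting problem against `A i ⊆ B i`
is solved by the cell attached along the given functor.

For the actual generators, chains contained in proper faces form a Dwyer sieve in `ξ([m] × [n])`,
with coreflection given by intersection. Under the adjunction between `K` and `N`, a square on a
generator becomes a compatible family on the proper faces; it glues to a functor on that sieve
because `cellComplex` has at most one arrow between two objects. No colimit of relative categories
has to be computed. -/

lemma RelativeCat.weq_eqToHom {X : RelativeCat.{u}} {x y : X} (e : x = y) : X.weq (eqToHom e) := by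
  subst e
  exact X.weq.id_mem _

/-! ### Dwyer sieves in relative posets -/

namespace RelPoset

/-- The order relation of a relative poset (for `false`) and its weak equivalences (for `true`). -/
def Rel (P : RelPoset.{u}) (σ : Bool) (x y : P) : Prop :=
  x ≤ y ∧ (σ = true → P.weq x y)

lemma Rel.le {P : RelPoset.{u}} {σ : Bool} {x y : P} (h : P.Rel σ x y) : x ≤ y := h.1

lemma Rel.refl (P : RelPoset.{u}) (σ : Bool) (x : P) : P.Rel σ x x :=
  ⟨le_rfl, fun _ => P.weq_refl x⟩

lemma Rel.trans {P : RelPoset.{u}} {σ : Bool} {x y z : P} (h : P.Rel σ x y) (h' : P.Rel σ y z) :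
    P.Rel σ x z :=
  ⟨h.1.trans h'.1, fun hσ => P.weq_trans (h.2 hσ) (h'.2 hσ)⟩

lemma rel_of_weq {P : RelPoset.{u}} {x y : P} (h : P.weq x y) (σ : Bool) : P.Rel σ x y :=
  ⟨P.le_of_weq h, fun _ => h⟩

/-- `r` is the coreflection of `b` in the subset `A`, for the order and for the weak equivalences,
and it is weakly equivalent to `b`. -/
structure IsRetract (P : RelPoset.{u}) (A : Set P) (r b : P) : Prop where
  mem : r ∈ A
  weq : P.weq r b
  rel {σ : Bool} {a : P} : a ∈ A → P.Rel σ a b → P.Rel σ a r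

lemma IsRetract.unique {P : RelPoset.{u}} {A : Set P} {r r' b : P} (h : P.IsRetract A r b)
    (h' : P.IsRetract A r' b) : r = r' :=
  le_antisymm (h'.rel h.mem (rel_of_weq h.weq false)).1 (h.rel h'.mem (rel_of_weq h'.weq false)).1

/-- A Dwyer sieve in a relative poset: a sieve such that the elements above it have
coreflections in it. -/
structure IsDwyerSieve (P : RelPoset.{u}) (A : Set P) : Prop where
  isLowerSet : IsLowerSet A
  exists_isRetract {a b : P} : a ∈ A → a ≤ b → ∃ r, P.IsRetract A r b

/-- The image of an element by a relative functor on a relative poset. -/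
abbrev onObj {P : RelPoset.{u}} {X : RelativeCat.{u}} (t : toRelativeCat.obj P ⟶ X) (x : P) : X :=
  t.functor.obj x

/-- The image of an inequality by a relative functor on a relative poset. -/
abbrev mapLE {P : RelPoset.{u}} {X : RelativeCat.{u}} (t : toRelativeCat.obj P ⟶ X) {x y : P}
    (h : x ≤ y) : onObj t x ⟶ onObj t y :=
  t.functor.map (@homOfLE P _ x y h)

lemma mapLE_refl {P : RelPoset.{u}} {X : RelativeCat.{u}} (t : toRelativeCat.obj P ⟶ X) (x : P) :
    mapLE t (le_refl x) = 𝟙 _ :=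
  t.functor.map_id x

lemma mapLE_comp {P : RelPoset.{u}} {X : RelativeCat.{u}} (t : toRelativeCat.obj P ⟶ X) {x y z : P}
    (h : x ≤ y) (h' : y ≤ z) : mapLE t h ≫ mapLE t h' = mapLE t (h.trans h') :=
  (t.functor.map_comp (@homOfLE P _ x y h) (@homOfLE P _ y z h')).symm

lemma mapLE_congr {P : RelPoset.{u}} {X : RelativeCat.{u}} (t : toRelativeCat.obj P ⟶ X)
    {x y x' y' : P} (hx : x = x') (hy : y = y') (h : x ≤ y) (h' : x' ≤ y') :
    mapLE t h = eqToHom (congrArg (onObj t) hx) ≫ mapLE t h' ≫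
      eqToHom (congrArg (onObj t) hy).symm := by
  subst hx hy
  simp

lemma mapLE_eq {P : RelPoset.{u}} {X : RelativeCat.{u}} {t t' : toRelativeCat.obj P ⟶ X}
    (e : t = t') {x y : P} (h : x ≤ y) :
    mapLE t h = eqToHom (by rw [e]) ≫ mapLE t' h ≫ eqToHom (by rw [e]) := by
  subst e
  simp

lemma eqToHom_mapLE {P : RelPoset.{u}} {X : RelativeCat.{u}} (t : toRelativeCat.obj P ⟶ X)
    {p p' : X} {x y z : P} (e : p = onObj t x) (e' : p' = onObj t y)
    (h : x ≤ y) (h' : y ≤ z) (h'' : x ≤ z) :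
    (eqToHom e ≫ mapLE t h ≫ eqToHom e'.symm) ≫ eqToHom e' ≫ mapLE t h' =
      eqToHom e ≫ mapLE t h'' := by
  subst e'
  simp [mapLE_comp]

lemma comp_eqToHom_mapLE {P : RelPoset.{u}} {X : RelativeCat.{u}} (t : toRelativeCat.obj P ⟶ X)
    {q p p' : X} (g : q ⟶ p) {x x' y z : P} (e : p = onObj t x) (e' : p' = onObj t y)
    (h : x ≤ y) (h' : y ≤ z) (k : x ≤ x') (k' : x' ≤ z) :
    (g ≫ eqToHom e ≫ mapLE t h ≫ eqToHom e'.symm) ≫ eqToHom e' ≫ mapLE t h' =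
      (g ≫ eqToHom e ≫ mapLE t k) ≫ mapLE t k' := by
  subst e'
  simp [mapLE_comp]

/-- The full relative subposet on a subset. -/
def sub (P : RelPoset.{u}) (A : Set P) : RelPoset.{u} where
  carrier := A
  weq x y := P.weq x y
  le_of_weq h := P.le_of_weq h
  weq_refl _ := P.weq_refl _
  weq_trans := P.weq_trans

/-- The inclusion of a full relative subposet. -/
def subι (P : RelPoset.{u}) (A : Set P) : P.sub A ⟶ P where
  toOrderHom := OrderHom.Subtype.val _
  map_weq h := h

end RelPoset

/-! ### The universal cell complex over a relative category -/

section CellComplex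

open RelPoset

variable {ι : Type} (B : ι → RelPoset.{u}) (A : ∀ i, Set (B i)) (X : RelativeCat.{u})

/-- The elements freely generated by attaching cells: `mk i t f b` is the copy of `b` in the cell
of type `i` over `t : B i ⟶ X`, attached along `f`. -/
inductive PreCell : Type u
  | mk (i : ι) (t : toRelativeCat.obj (B i) ⟶ X) (f : A i → PreCell) (b : B i)

namespace PreCell

variable {B A X}

/-- The underlying object of `X`. -/
def obj : PreCell B A X → X
  | mk _ t _ b => onObj t b

/-- The height of the tree of attaching maps. -/
noncomputable def depth : PreCell B A X → Ordinal.{u}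
  | mk _ _ f _ => ⨆ a, Order.succ (depth (f a))

lemma depth_lt (i : ι) (t : toRelativeCat.obj (B i) ⟶ X) (f : A i → PreCell B A X) (b : B i)
    (a : A i) : (f a).depth < (mk i t f b).depth := by
  rw [depth]
  exact (Order.lt_succ _).trans_le (Ordinal.le_iSup (fun a => Order.succ (depth (f a))) a)

/-- The morphisms of `X` underlying the order relation (for `false`) and the
weak equivalences (for `true`). -/
inductive Arr (σ : Bool) : ∀ w z : PreCell B A X, (w.obj ⟶ z.obj) → Prop
  | same (i : ι) (t : toRelativeCat.obj (B i) ⟶ X) (f : A i → PreCell B A X) {b' b : B i}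
      (h : (B i).Rel σ b' b) : Arr σ (mk i t f b') (mk i t f b) (mapLE t h.le)
  | through {w : PreCell B A X} (i : ι) (t : toRelativeCat.obj (B i) ⟶ X)
      (f : A i → PreCell B A X) {b : B i} (r : A i) (hr : (B i).IsRetract (A i) r b)
      (e : (f r).obj = onObj t r) (g : w.obj ⟶ (f r).obj) (hg : Arr σ w (f r) g) :
      Arr σ w (mk i t f b) (g ≫ eqToHom e ≫ mapLE t ((B i).le_of_weq hr.weq))

lemma Arr.congr {σ : Bool} {w z : PreCell B A X} {g g' : w.obj ⟶ z.obj} (h : Arr σ w z g)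
    (e : g = g') : Arr σ w z g' :=
  e ▸ h

lemma Arr.depth_le {σ : Bool} {w z : PreCell B A X} {g : w.obj ⟶ z.obj} (h : Arr σ w z g) :
    w.depth ≤ z.depth := by
  induction h with
  | same i t f h => simp [depth]
  | through i t f r hr e g hg ih => exact ih.trans (depth_lt i t f _ r).le

/-- The two constructors never compete: `same` preserves depth, while `through` ends strictly deeper
than `f r`, hence than `w`. In the `through` case the intermediate point is forced, coreflections
being unique. -/
lemma Arr.unique {σ τ : Bool} {w z : PreCell B A X} {g g' : w.obj ⟶ z.obj} (h : Arr σ w z g)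
    (h' : Arr τ w z g') : g = g' := by
  induction h with
  | same i t f h =>
    cases h' with
    | same => rfl
    | through _ _ _ r hr e g hg => exact absurd hg.depth_le (depth_lt i t f _ r).not_ge
  | through i t f r hr e g hg ih =>
    cases h' with
    | same => exact absurd hg.depth_le (depth_lt i t f _ r).not_ge
    | through _ _ _ r' hr' e' g' hg' =>
      obtain rfl : r = r' := Subtype.ext (hr.unique hr')
      rw [ih hg']

lemma Arr.weq {w z : PreCell B A X} {g : w.obj ⟶ z.obj} (h : Arr true w z g) :
    X.weq g := by
  induction h with
  | same i t f h => exact t.map_weq _ (h.2 rfl)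
  | through i t f r hr e g hg ih =>
    exact X.weq.comp_mem _ _ ih (X.weq.comp_mem _ _ (RelativeCat.weq_eqToHom e)
      (t.map_weq _ hr.weq))

/-- An element is valid if, hereditarily, the attaching map is a relative functor over `X` and the
elements are not in the part of the cell that is glued to previous ones. -/
def Valid : PreCell B A X → Prop
  | mk i t f b => b ∉ A i ∧ (∀ a, Valid (f a)) ∧
      ∃ e : ∀ a, (f a).obj = onObj t a, ∀ (σ : Bool) (a a' : A i) (h : (B i).Rel σ a a'),
        Arr σ (f a) (f a') (eqToHom (e a) ≫ mapLE t h.le ≫ eqToHom (e a').symm)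

lemma Arr.refl (σ : Bool) (z : PreCell B A X) : Arr σ z z (𝟙 _) := by
  cases z with
  | mk i t f b =>
    have := Arr.same i t f (Rel.refl (B i) σ b)
    rwa [mapLE_refl] at this

/-- Induction on the target. The essential case is an arrow entering a cell through `r` and then
moving up inside the cell to `b`: the coreflection `r'` of `b` satisfies `r ≤ r'`, and validity of
the target makes `f r ⟶ f r'` an arrow, so the composite enters through `r'`. -/
lemma Arr.trans (hA : ∀ i, (B i).IsDwyerSieve (A i)) {σ : Bool} {y : PreCell B A X}
    (hy : y.Valid) {w z : PreCell B A X} {g : w.obj ⟶ z.obj} {h : z.obj ⟶ y.obj}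
    (hg : Arr σ w z g) (hh : Arr σ z y h) : Arr σ w y (g ≫ h) := by
  induction y generalizing w z with
  | mk i t f b ih =>
    obtain ⟨-, hf, e, he⟩ := hy
    cases hh with
    | through _ _ _ r hr e' h hh =>
      have := Arr.through i t f r hr e' _ (ih r (hf r) hg hh)
      simpa using this
    | @same _ _ _ b' _ hb =>
      cases hg with
      | @same _ _ _ b'' _ hb' =>
        exact (Arr.same i t f (hb'.trans hb)).congr (mapLE_comp t hb'.le hb.le).symm
      | through _ _ _ r hr e' g hg =>
        have hrb := (rel_of_weq hr.weq σ).trans hb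
        obtain ⟨r', hr'⟩ := (hA i).exists_isRetract r.2 hrb.1
        refine (Arr.through i t f ⟨r', hr'.mem⟩ hr' (e _) _
          (ih _ (hf _) hg (he σ r ⟨r', hr'.mem⟩ (hr'.rel r.2 hrb)))).congr ?_
        exact comp_eqToHom_mapLE t g _ (e _) _ _ _ _

end PreCell

variable {B A}

open PreCell in
/-- The category of valid elements. -/
abbrev cellCategory (hA : ∀ i, (B i).IsDwyerSieve (A i)) :
    SmallCategory { z : PreCell B A X // z.Valid } where
  Hom := fun w z => { g : w.1.obj ⟶ z.1.obj // Arr false w.1 z.1 g }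
  id := fun _ => ⟨𝟙 _, Arr.refl _ _⟩
  comp := fun {_ _ y} g h => ⟨g.1 ≫ h.1, Arr.trans hA y.2 g.2 h.2⟩
  id_comp := fun g => Subtype.ext (Category.id_comp g.1)
  comp_id := fun g => Subtype.ext (Category.comp_id g.1)
  assoc := fun g h k => Subtype.ext (Category.assoc g.1 h.1 k.1)

open PreCell in
/-- The universal cell complex over `X`. -/
def cellComplex (hA : ∀ i, (B i).IsDwyerSieve (A i)) : RelativeCat.{u} :=
  letI := cellCategory X hA
  { carrier := { z : PreCell B A X // z.Valid }
    weq := fun w z (g : { g : w.1.obj ⟶ z.1.obj // Arr false w.1 z.1 g }) =>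
      Arr true w.1 z.1 g.1
    isMultiplicative :=
      { id_mem := fun z => Arr.refl true z.1
        comp_mem := fun {_ _ y} _ _ h h' => Arr.trans hA y.2 h h' } }

variable (hA : ∀ i, (B i).IsDwyerSieve (A i))

/-- The projection of the universal cell complex. -/
def cellComplexπ : cellComplex X hA ⟶ X where
  functor :=
    { obj := fun z => z.1.obj
      map := fun g => g.1
      map_id := fun _ => rfl
      map_comp := fun _ _ => rfl }
  map_weq w z g (h : PreCell.Arr true w.1 z.1 (Subtype.val g)) := h.weq

instance cellComplex_subsingleton_hom (w z : cellComplex X hA) : Subsingleton (w ⟶ z) :=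
  ⟨fun g g' => Subtype.ext (g.2.unique g'.2)⟩

/-- Arrows never lower the depth, and those of type `through` from a point to a new cell raise it
strictly. Lexicographic induction on the depth and then on the position in the cell gives
well-foundedness. -/
lemma isDirectPoset_cellComplex (hB : ∀ i, WellFoundedLT (B i)) :
    IsDirectPoset (cellComplex X hA) where
  subsingleton_hom := inferInstance
  antisymm := by
    rintro ⟨w, hw⟩ ⟨z, hz⟩ ⟨g, hg⟩ ⟨g', hg'⟩
    dsimp only at g hg g' hg'
    refine Subtype.ext ?_
    have h1 := hg.depth_le
    have h2 := hg'.depth_le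
    cases hg with
    | @same i t f b' b h =>
      cases hg' with
      | same _ _ _ h' => exact congrArg (PreCell.mk i t f) (le_antisymm h.1 h'.1)
      | through _ _ _ r hr e g hg => exact absurd hg.depth_le (PreCell.depth_lt i t f _ r).not_ge
    | through i t f r hr e g hg =>
      exact absurd (h2.trans hg.depth_le) (PreCell.depth_lt i t f _ r).not_ge
  wellFounded := by
    refine ⟨fun z => ?_⟩
    induction hd : z.1.depth using WellFoundedLT.induction generalizing z with
    | ind d ihd =>
      subst hd
      obtain ⟨⟨i, t, f, b⟩, hz⟩ := z
      induction b using WellFoundedLT.induction with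
      | ind b ihb =>
        refine ⟨_, ?_⟩
        rintro ⟨w, hw⟩ ⟨hne, ⟨⟨g, hg⟩⟩⟩
        dsimp only at g hg
        cases hg with
        | @same _ _ _ b' _ h =>
          refine ihb b' (lt_of_le_of_ne h.1 ?_) hw ?_
          · rintro rfl
            exact hne rfl
          -- The depth of `mk i t f b` does not depend on `b`, so the outer induction hypothesis
          -- passes to `b'`.
          · intro d hd y hy
            exact ihd d (hd.trans_eq (by simp [PreCell.depth])) y hy
        | through _ _ _ r hr e g hg =>
          exact ihd _ (hg.depth_le.trans_lt (PreCell.depth_lt i t f b r)) _ rfl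

open PreCell in
/-- The projection of the universal cell complex has the right lifting property with respect to
the inclusions of the sieves in the cells. -/
lemma hasLiftingProperty_cellComplexπ (i : ι) :
    HasLiftingProperty (toRelativeCat.map ((B i).subι (A i))) (cellComplexπ X hA) where
  sq_hasLift {F t} sq := by
    classical
    have e (a : A i) : (F.functor.obj a).1.obj = onObj t a :=
      congrArg (fun G : toRelativeCat.obj ((B i).sub (A i)) ⟶ X => G.functor.obj a) sq.w
    have hF (σ : Bool) (a a' : A i) (h : (B i).Rel σ a a') :
        Arr σ (F.functor.obj a).1 (F.functor.obj a').1
          (eqToHom (e a) ≫ mapLE t h.le ≫ eqToHom (e a').symm) := by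
      let k := @homOfLE ((B i).sub (A i)) _ a a' h.1
      have hk : (F.functor.map k).1 = eqToHom (e a) ≫ mapLE t h.le ≫ eqToHom (e a').symm := by
        have hw : F.functor ⋙ (cellComplexπ X hA).functor =
          (toRelativeCat.map ((B i).subι (A i))).functor ⋙ t.functor :=
            congrArg RelativeCat.Hom.functor sq.w
        exact Functor.congr_hom hw k
      refine Arr.congr ?_ hk
      cases σ with
      | false => exact (F.functor.map k).2
      | true => exact F.map_weq k (h.2 rfl)
    -- The attaching map of the new cell is `F` itself; its functoriality is exactly what `Valid`
    -- requires.
    let L (b : B i) : PreCell B A X :=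
      if hb : b ∈ A i then (F.functor.obj ⟨b, hb⟩).1 else mk i t (fun a => (F.functor.obj a).1) b
    have L_mem {b : B i} (hb : b ∈ A i) : L b = (F.functor.obj ⟨b, hb⟩).1 := dif_pos hb
    have L_notMem {b : B i} (hb : b ∉ A i) : L b = mk i t (fun a => (F.functor.obj a).1) b :=
      dif_neg hb
    have L_valid (b : B i) : (L b).Valid := by
      by_cases hb : b ∈ A i
      · rw [L_mem hb]
        exact (F.functor.obj _).2
      · rw [L_notMem hb]
        exact ⟨hb, fun a => (F.functor.obj a).2, e, hF⟩
    have L_obj (b : B i) : (L b).obj = onObj t b := by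
      by_cases hb : b ∈ A i
      · rw [L_mem hb]
        exact e ⟨b, hb⟩
      · rw [L_notMem hb]
        rfl
    have L_arr (σ : Bool) (b b' : B i) (h : (B i).Rel σ b b') :
        Arr σ (L b) (L b') (eqToHom (L_obj b) ≫ mapLE t h.le ≫ eqToHom (L_obj b').symm) := by
      -- The type of the underlying morphism depends on the endpoints, so the case split on `L` is
      -- transported along equalities of points.
      have key {y y' : PreCell B A X} (hy : L b = y) (hy' : L b' = y') (o : y.obj = onObj t b)
          (o' : y'.obj = t.functor.obj b')
          (H : Arr σ y y' (eqToHom o ≫ mapLE t h.le ≫ eqToHom o'.symm)) :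
          Arr σ (L b) (L b') (eqToHom (L_obj b) ≫ mapLE t h.le ≫ eqToHom (L_obj b').symm) := by
        subst hy hy'
        exact H
      by_cases hb' : b' ∈ A i
      · have hb : b ∈ A i := (hA i).isLowerSet h.1 hb'
        exact key (L_mem hb) (L_mem hb') (e ⟨b, hb⟩) (e ⟨b', hb'⟩) (hF σ ⟨b, hb⟩ ⟨b', hb'⟩ h)
      · by_cases hb : b ∈ A i
        -- From the sieve to the new cell: pass through the coreflection of `b'`.
        · obtain ⟨r, hr⟩ := (hA i).exists_isRetract hb h.1
          refine key (L_mem hb) (L_notMem hb') (e ⟨b, hb⟩) rfl ?_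
          refine (Arr.through i t (fun a => (F.functor.obj a).1) ⟨r, hr.mem⟩ hr (e _) _
            (hF σ ⟨b, hb⟩ ⟨r, hr.mem⟩ (hr.rel hb h))).congr ?_
          refine (eqToHom_mapLE t _ (e ⟨r, hr.mem⟩) _ _ h.le).trans ?_
          exact congrArg _ (Category.comp_id _).symm
        · refine key (L_notMem hb) (L_notMem hb') rfl rfl ?_
          refine (Arr.same i t (fun a => (F.functor.obj a).1) h).congr ?_
          exact (Category.comp_id _).symm.trans (Category.id_comp _).symm
    let l : toRelativeCat.obj (B i) ⟶ cellComplex X hA :=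
      { functor :=
          { obj := fun b => ⟨L b, L_valid b⟩
            map := fun {b b'} h => ⟨_, L_arr false b b' ⟨leOfHom h, by simp⟩⟩
            map_id := fun _ => (cellComplex_subsingleton_hom X hA _ _).elim _ _
            map_comp := fun _ _ => (cellComplex_subsingleton_hom X hA _ _).elim _ _ }
        map_weq := fun b b' h hw => L_arr true b b' ⟨leOfHom h, fun _ => hw⟩ }
    refine ⟨⟨⟨l, ?_, ?_⟩⟩⟩
    · ext1
      refine CategoryTheory.Functor.ext (fun a => Subtype.ext (L_mem a.2))
        (fun _ _ _ => Subsingleton.elim _ _)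
    · ext1
      exact CategoryTheory.Functor.ext L_obj (fun _ _ _ => rfl)

end CellComplex

/-! ### Subdivisions, their boundaries, and retractions onto faces -/

namespace RelPoset

instance {X : Type*} [PartialOrder X] : WellFoundedLT (NonemptyFiniteChains X) :=
  ⟨InvImage.wf NonemptyFiniteChains.finset wellFounded_lt⟩

instance (P : RelPoset.{u}) : WellFoundedLT (xiT.obj P) :=
  inferInstanceAs (WellFoundedLT (NonemptyFiniteChains P))

/-- The chains contained in a given subset. -/
def chainsIn (P : RelPoset.{u}) (U : Set P) : Set (xiT.obj P) :=
  { c : NonemptyFiniteChains P | ∀ x ∈ c.finset, x ∈ U }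

/-- The coreflection of a chain `b` is `b ∩ U`. As `U` is an upper set, this keeps the last element
of `b`, the only one that weak equivalences of `ξ_t` see. -/
lemma isDwyerSieve_chainsIn (P : RelPoset.{u}) {U : Set P} (hU : IsUpperSet U) :
    (xiT.obj P).IsDwyerSieve (P.chainsIn U) where
  isLowerSet := fun _ _ h hb x hx => hb x (h hx)
  exists_isRetract {a b} ha hab := by
    classical
    change NonemptyFiniteChains P at a b
    change a.finset ⊆ b.finset at hab
    obtain ⟨x, hx⟩ := a.nonempty
    let r : NonemptyFiniteChains P :=
      { finset := b.finset.filter (· ∈ U)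
        nonempty := ⟨x, Finset.mem_filter.2 ⟨hab hx, ha x hx⟩⟩
        comparable := fun y z => b.comparable ⟨y.1, (Finset.mem_filter.1 y.2).1⟩
          ⟨z.1, (Finset.mem_filter.1 z.2).1⟩ }
    have hr {y : P} : y ∈ r.finset ↔ y ∈ b.finset ∧ y ∈ U := Finset.mem_filter
    obtain ⟨M, hM⟩ := exists_isGreatest b
    have hrM : IsGreatest (r.finset : Set P) M :=
      ⟨hr.2 ⟨hM.1, hU (hM.2 (hab hx)) (ha x hx)⟩, fun y hy => hM.2 (hr.1 hy).1⟩
    refine ⟨r, fun y hy => (hr.1 hy).2, ⟨fun y hy => (hr.1 hy).1, M, M, hrM, hM, P.weq_refl M⟩, ?_⟩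
    intro σ a' ha' h
    have hle : ∀ y ∈ NonemptyFiniteChains.finset a', y ∈ r.finset :=
      fun y hy => hr.2 ⟨h.1 hy, ha' y hy⟩
    refine ⟨hle, fun hσ => ?_⟩
    obtain ⟨-, y, z, hy, hz, w⟩ := h.2 hσ
    exact ⟨hle, y, M, hy, hrM, hz.unique hM ▸ w⟩

/-- The union of the chains that are the elements of an element of `ξ P`. -/
def support {P : RelPoset.{u}} (c : NonemptyFiniteChains (NonemptyFiniteChains P)ᵒᵈ) : Set P :=
  { x | ∃ A ∈ c.finset, x ∈ (OrderDual.ofDual A).finset }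

lemma support_mono {P : RelPoset.{u}} {c d : NonemptyFiniteChains (NonemptyFiniteChains P)ᵒᵈ}
    (h : c ≤ d) : support c ⊆ support d :=
  fun _ ⟨A, hA, hx⟩ => ⟨A, h hA, hx⟩

lemma support_nonempty {P : RelPoset.{u}} (c : NonemptyFiniteChains (NonemptyFiniteChains P)ᵒᵈ) :
    (support c).Nonempty := by
  obtain ⟨A, hA⟩ := c.nonempty
  obtain ⟨x, hx⟩ := (OrderDual.ofDual A).nonempty
  exact ⟨x, A, hA, hx⟩

/-- The map on elements induced by a morphism on the two-fold subdivision. -/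
noncomputable abbrev xiMap {P Q : RelPoset.{u}} (f : P ⟶ Q)
    (c : NonemptyFiniteChains (NonemptyFiniteChains P)ᵒᵈ) :
    NonemptyFiniteChains (NonemptyFiniteChains Q)ᵒᵈ :=
  (xi.map f).toOrderHom c

lemma mem_xiMap {P Q : RelPoset.{u}} (f : P ⟶ Q)
    (c : NonemptyFiniteChains (NonemptyFiniteChains P)ᵒᵈ) (B : (NonemptyFiniteChains Q)ᵒᵈ) :
    B ∈ (xiMap f c).finset ↔ ∃ A ∈ c.finset,
      OrderDual.toDual ((OrderDual.ofDual A).map f.toOrderHom) = B :=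
  NonemptyFiniteChains.mem_map_iff _ _ _

lemma mem_support_xiMap {P Q : RelPoset.{u}} (f : P ⟶ Q)
    (c : NonemptyFiniteChains (NonemptyFiniteChains P)ᵒᵈ) (y : Q) :
    y ∈ support (xiMap f c) ↔ ∃ x ∈ support c, f.toOrderHom x = y := by
  constructor
  · rintro ⟨B, hB, hy⟩
    obtain ⟨A, hA, rfl⟩ := (mem_xiMap f c B).1 hB
    obtain ⟨x, hx, rfl⟩ := (NonemptyFiniteChains.mem_map_iff _ _ _).1 hy
    exact ⟨x, ⟨A, hA, hx⟩, rfl⟩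
  · rintro ⟨x, ⟨A, hA, hx⟩, rfl⟩
    exact ⟨_, (mem_xiMap f c _).2 ⟨A, hA, rfl⟩, (NonemptyFiniteChains.mem_map_iff _ _ _).2
      ⟨x, hx, rfl⟩⟩

lemma xiMap_congr {P Q : RelPoset.{u}} {f g : P ⟶ Q}
    {c : NonemptyFiniteChains (NonemptyFiniteChains P)ᵒᵈ}
    (h : ∀ x ∈ support c, f.toOrderHom x = g.toOrderHom x) : xiMap f c = xiMap g c := by
  have key : ∀ A ∈ c.finset,
      (OrderDual.ofDual A).map f.toOrderHom = (OrderDual.ofDual A).map g.toOrderHom := by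
    intro A hA
    ext y
    rw [NonemptyFiniteChains.mem_map_iff, NonemptyFiniteChains.mem_map_iff]
    exact exists_congr fun x => and_congr_right fun hx => by rw [h x ⟨A, hA, hx⟩]
  ext B
  rw [mem_xiMap, mem_xiMap]
  exact exists_congr fun A => and_congr_right fun hA => by rw [key A hA]

lemma xiMap_id {P : RelPoset.{u}} (c : NonemptyFiniteChains (NonemptyFiniteChains P)ᵒᵈ) :
    xiMap (𝟙 P) c = c :=
  congrArg (fun f : xi.obj P ⟶ xi.obj P => f.toOrderHom c) (xi.map_id P)

/-- The chains in `[m] × [n]` that are contained in a proper face. -/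
def boundaryChains (p : SimplexCategory × SimplexCategory) : Set (xiI.obj (grid.{u}.obj p)) :=
  { A : (NonemptyFiniteChains (grid.{u}.obj p))ᵒᵈ |
    (∃ i, ∀ x ∈ (OrderDual.ofDual A).finset, x.down.1 ≠ i) ∨
    ∃ j, ∀ x ∈ (OrderDual.ofDual A).finset, x.down.2 ≠ j }

lemma isUpperSet_boundaryChains (p : SimplexCategory × SimplexCategory) :
    IsUpperSet (boundaryChains.{u} p) := by
  rintro A B h (⟨i, hi⟩ | ⟨j, hj⟩)
  · exact Or.inl ⟨i, fun x hx => hi x (h hx)⟩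
  · exact Or.inr ⟨j, fun x hx => hj x (h hx)⟩

/-- The union of the two-fold subdivisions of the proper faces of `[m] × [n]`. -/
def xiBoundary (p : SimplexCategory × SimplexCategory) : Set (xi.obj (grid.{u}.obj p)) :=
  (xiI.obj (grid.{u}.obj p)).chainsIn (boundaryChains p)

lemma isDwyerSieve_xiBoundary (p : SimplexCategory × SimplexCategory) :
    (xi.obj (grid.{u}.obj p)).IsDwyerSieve (xiBoundary p) :=
  isDwyerSieve_chainsIn _ (isUpperSet_boundaryChains p)

/-- For reverse inclusion, the least member of `c` is its largest chain, which is the whole support;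
so a single proper face works for all members at once. -/
lemma mem_xiBoundary_iff {p : SimplexCategory × SimplexCategory}
    (c : NonemptyFiniteChains (NonemptyFiniteChains (grid.{u}.obj p))ᵒᵈ) :
    c ∈ xiBoundary p ↔
      (∃ i, ∀ x ∈ support c, x.down.1 ≠ i) ∨ ∃ j, ∀ x ∈ support c, x.down.2 ≠ j := by
  constructor
  · intro hc
    obtain ⟨A, hA⟩ := exists_isLeast c
    have hs : ∀ x ∈ support c, x ∈ (OrderDual.ofDual A).finset :=
      fun x ⟨A', hA', hx⟩ => hA.2 hA' hx
    obtain ⟨i, hi⟩ | ⟨j, hj⟩ := hc A hA.1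
    · exact Or.inl ⟨i, fun x hx => hi x (hs x hx)⟩
    · exact Or.inr ⟨j, fun x hx => hj x (hs x hx)⟩
  · rintro (⟨i, hi⟩ | ⟨j, hj⟩) A hA
    · exact Or.inl ⟨i, fun x hx => hi x ⟨A, hA, hx⟩⟩
    · exact Or.inr ⟨j, fun x hx => hj x ⟨A, hA, hx⟩⟩

lemma exists_idempotent {k : ℕ} {U : Set (Fin (k + 1))} (hU : U.Nonempty) :
    ∃ e : Fin (k + 1) →o Fin (k + 1), (∀ i, e i ∈ U) ∧ ∀ i ∈ U, e i = i := by
  classical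
  have hV : U.toFinset.Nonempty := by simpa using hU
  -- Send `i` to the greatest element of `U` below it. If there is none, the empty supremum is `0`,
  -- possibly outside `U`, and the maximum replaces it by the least element of `U`.
  refine ⟨⟨fun i => max (U.toFinset.min' hV) ((U.toFinset.filter (· ≤ i)).sup id), ?_⟩, ?_, ?_⟩
  · intro i j h
    refine max_le_max le_rfl (Finset.sup_mono fun x hx => ?_)
    rw [Finset.mem_filter] at hx ⊢
    exact ⟨hx.1, hx.2.trans h⟩
  · intro i
    change max (U.toFinset.min' hV) ((U.toFinset.filter (· ≤ i)).sup id) ∈ U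
    rcases max_choice (U.toFinset.min' hV) ((U.toFinset.filter (· ≤ i)).sup id) with h | h
    · rw [h]
      exact Set.mem_toFinset.1 (Finset.min'_mem _ hV)
    · rcases (U.toFinset.filter (· ≤ i)).eq_empty_or_nonempty with h' | h'
      · rw [h', Finset.sup_empty, max_bot_right]
        exact Set.mem_toFinset.1 (Finset.min'_mem _ hV)
      · rw [h]
        obtain ⟨x, hx, hx'⟩ := Finset.exists_mem_eq_sup _ h' id
        rw [hx']
        exact Set.mem_toFinset.1 (Finset.mem_filter.1 hx).1
  · intro i hi
    have hi' := Set.mem_toFinset.2 hi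
    refine le_antisymm (max_le (Finset.min'_le _ _ hi') ?_) (le_max_of_le_right ?_)
    · exact Finset.sup_le fun x hx => (Finset.mem_filter.1 hx).2
    · exact Finset.le_sup (f := id) (Finset.mem_filter.2 ⟨hi', le_rfl⟩)

/-- A morphism to `[m] × [n]` that factors through a proper face. -/
def IsBoundary {q p : SimplexCategory × SimplexCategory} (g : q ⟶ p) : Prop :=
  ¬ Function.Surjective g.1.toOrderHom ∨ ¬ Function.Surjective g.2.toOrderHom

lemma IsBoundary.comp {r q p : SimplexCategory × SimplexCategory} {g : q ⟶ p} (hg : IsBoundary g)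
    (f : r ⟶ q) : IsBoundary (f ≫ g) :=
  hg.imp (fun h h' => h (Function.Surjective.of_comp h'))
    (fun h h' => h (Function.Surjective.of_comp h'))

lemma IsBoundary.xiMap_mem {q p : SimplexCategory × SimplexCategory} {g : q ⟶ p}
    (hg : IsBoundary g) (c : NonemptyFiniteChains (NonemptyFiniteChains (grid.{u}.obj q))ᵒᵈ) :
    xiMap (grid.map g) c ∈ xiBoundary p := by
  rw [mem_xiBoundary_iff]
  refine hg.imp (fun h => ?_) (fun h => ?_) <;>
  · simp only [Function.Surjective, not_forall, not_exists] at h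
    obtain ⟨i, hi⟩ := h
    refine ⟨i, fun x hx => ?_⟩
    obtain ⟨y, -, rfl⟩ := (mem_support_xiMap _ _ _).1 hx
    exact hi _

/-- An endomorphism of `[m] × [n]` which is a retraction on the smallest face containing `c`. -/
structure IsFaceRetraction {p : SimplexCategory × SimplexCategory}
    (c : NonemptyFiniteChains (NonemptyFiniteChains (grid.{u}.obj p))ᵒᵈ) (e : p ⟶ p) : Prop where
  exists_fst (i) : ∃ x ∈ support c, x.down.1 = e.1.toOrderHom i
  exists_snd (j) : ∃ x ∈ support c, x.down.2 = e.2.toOrderHom j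
  map_eq {x} : x ∈ support c → (grid.map e).toOrderHom x = x

lemma exists_isFaceRetraction {p : SimplexCategory × SimplexCategory}
    (c : NonemptyFiniteChains (NonemptyFiniteChains (grid.{u}.obj p))ᵒᵈ) :
    ∃ e : p ⟶ p, IsFaceRetraction c e := by
  obtain ⟨e₁, h₁, h₁'⟩ := exists_idempotent
    ((support_nonempty c).image (fun x : grid.{u}.obj p => x.down.1))
  obtain ⟨e₂, h₂, h₂'⟩ := exists_idempotent
    ((support_nonempty c).image (fun x : grid.{u}.obj p => x.down.2))
  exact ⟨(SimplexCategory.Hom.mk e₁, SimplexCategory.Hom.mk e₂), h₁, h₂, fun {x} hx =>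
    ULift.ext _ _ (Prod.ext (h₁' _ ⟨x, hx, rfl⟩) (h₂' _ ⟨x, hx, rfl⟩))⟩

lemma IsFaceRetraction.xiMap_eq {p : SimplexCategory × SimplexCategory}
    {c d : NonemptyFiniteChains (NonemptyFiniteChains (grid.{u}.obj p))ᵒᵈ} {e : p ⟶ p}
    (h : IsFaceRetraction c e) (hd : d ≤ c) : xiMap (grid.map e) d = d := by
  conv_rhs => rw [← xiMap_id d]
  exact xiMap_congr fun x hx => h.map_eq (support_mono hd hx)

lemma IsFaceRetraction.isBoundary {p : SimplexCategory × SimplexCategory}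
    {c : NonemptyFiniteChains (NonemptyFiniteChains (grid.{u}.obj p))ᵒᵈ} {e : p ⟶ p}
    (h : IsFaceRetraction c e) (hc : c ∈ xiBoundary p) : IsBoundary e := by
  refine ((mem_xiBoundary_iff c).1 hc).imp ?_ ?_ <;> rintro ⟨i, hi⟩ h'
  · obtain ⟨j, rfl⟩ := h' i
    obtain ⟨x, hx, hx'⟩ := h.exists_fst j
    exact hi x hx hx'
  · obtain ⟨j, rfl⟩ := h' i
    obtain ⟨x, hx, hx'⟩ := h.exists_snd j
    exact hi x hx hx'

/-- Maps of grids act coordinatewise, and each coordinate of a value of `e` is a coordinate of some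
element of the support. -/
lemma IsFaceRetraction.comp_eq_comp {q p : SimplexCategory × SimplexCategory}
    {c : NonemptyFiniteChains (NonemptyFiniteChains (grid.{u}.obj q))ᵒᵈ} {e : q ⟶ q}
    (h : IsFaceRetraction c e) {g g' : q ⟶ p}
    (hg : ∀ x ∈ support c, (grid.{u}.map g).toOrderHom x = (grid.map g').toOrderHom x) :
    e ≫ g = e ≫ g' := by
  refine Prod.ext (SimplexCategory.Hom.ext _ _ (OrderHom.ext _ _ (funext fun i => ?_)))
    (SimplexCategory.Hom.ext _ _ (OrderHom.ext _ _ (funext fun i => ?_)))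
  · obtain ⟨x, hx, hx'⟩ := h.exists_fst i
    change g.1.toOrderHom (e.1.toOrderHom i) = g'.1.toOrderHom (e.1.toOrderHom i)
    rw [← hx']
    exact congrArg (fun y : grid.{u}.obj p => y.down.1) (hg x hx)
  · obtain ⟨x, hx, hx'⟩ := h.exists_snd i
    change g.2.toOrderHom (e.2.toOrderHom i) = g'.2.toOrderHom (e.2.toOrderHom i)
    rw [← hx']
    exact congrArg (fun y : grid.{u}.obj p => y.down.2) (hg x hx)

end RelPoset

/-! ### Gluing compatible families on proper faces -/

section Gluing

lemma eqToHom_conj {C : Type*} [Category C] {a b c d d' x y : C} (h₁ : a = b) (h₂ : b = c)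
    (h₃ : c = x) (f : x ⟶ y) (h₄ : y = d) (h₅ : d = d') (h₆ : a = x) (h₇ : y = d') :
    eqToHom h₁ ≫ eqToHom h₂ ≫ (eqToHom h₃ ≫ f ≫ eqToHom h₄) ≫ eqToHom h₅ =
      eqToHom h₆ ≫ f ≫ eqToHom h₇ := by
  subst h₁ h₂ h₃ h₄ h₅
  simp

open RelPoset RelativeCat

variable {p : SimplexCategory × SimplexCategory} {Z : RelativeCat.{u}}

/-- A compatible family of relative functors on the proper faces of `ξ([m] × [n])`. -/
structure BoundaryFamily (p : SimplexCategory × SimplexCategory) (Z : RelativeCat.{u}) where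
  app {q : SimplexCategory × SimplexCategory} (g : q ⟶ p) (hg : IsBoundary g) : xiGrid.obj q ⟶ Z
  app_comp {r q : SimplexCategory × SimplexCategory} (f : r ⟶ q) (g : q ⟶ p) (hg : IsBoundary g) :
    app (f ≫ g) (hg.comp f) = xiGrid.map f ≫ app g hg

namespace BoundaryFamily

variable (a : BoundaryFamily p Z)

/-- The value of a compatible family on an object. -/
noncomputable abbrev val {q : SimplexCategory × SimplexCategory} (g : q ⟶ p) (hg : IsBoundary g)
    (c : NonemptyFiniteChains (NonemptyFiniteChains (grid.{u}.obj q))ᵒᵈ) : Z :=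
  onObj (P := xi.obj (grid.obj q)) (a.app g hg) c

lemma val_comp {r q : SimplexCategory × SimplexCategory} (f : r ⟶ q) (g : q ⟶ p)
    (hg : IsBoundary g) (c : NonemptyFiniteChains (NonemptyFiniteChains (grid.{u}.obj r))ᵒᵈ) :
    a.val (f ≫ g) (hg.comp f) c = a.val g hg (xiMap (grid.map f) c) :=
  congrArg (fun F : xiGrid.obj r ⟶ Z => F.functor.obj c) (a.app_comp f g hg)

/-- Precomposing with a face retraction `e` for `c` leaves `c` unchanged and makes `g` and `g'`
equal. -/
lemma val_congr {q : SimplexCategory × SimplexCategory} {g g' : q ⟶ p} (hg : IsBoundary g)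
    (hg' : IsBoundary g') (c : NonemptyFiniteChains (NonemptyFiniteChains (grid.{u}.obj q))ᵒᵈ)
    (h : ∀ x ∈ support c, (grid.{u}.map g).toOrderHom x = (grid.map g').toOrderHom x) :
    a.val g hg c = a.val g' hg' c := by
  obtain ⟨e, he⟩ := exists_isFaceRetraction c
  have h₁ := a.val_comp e g hg c
  have h₂ := a.val_comp e g' hg' c
  rw [he.xiMap_eq le_rfl] at h₁ h₂
  rw [← h₁, ← h₂]
  congr 1
  simp only [he.comp_eq_comp h]

/-- Independence of the chosen face: `e` fixes the support of `d`, so `g ≫ e` and `g` agree on the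
support of `c`. -/
lemma val_congr_of_xiMap {q : SimplexCategory × SimplexCategory} {g : q ⟶ p} (hg : IsBoundary g)
    (c : NonemptyFiniteChains (NonemptyFiniteChains (grid.{u}.obj q))ᵒᵈ)
    (d : NonemptyFiniteChains (NonemptyFiniteChains (grid.{u}.obj p))ᵒᵈ)
    (hd : xiMap (grid.map g) c = d) {e : p ⟶ p} (he : IsFaceRetraction d e) (he' : IsBoundary e) :
    a.val e he' d = a.val g hg c := by
  subst hd
  rw [← a.val_comp g e he']
  refine a.val_congr _ _ _ fun x hx => ?_
  rw [grid.map_comp]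
  exact he.map_eq ((mem_support_xiMap _ _ _).2 ⟨x, hx, rfl⟩)

/-- A compatible family with values in a relative category with at most one morphism between any
two objects induces a relative functor on the boundary. -/
lemma exists_glue [hZ : ∀ x y : Z, Subsingleton (x ⟶ y)] {X : RelativeCat.{u}} (π : Z ⟶ X)
    (t : xiGrid.obj p ⟶ X)
    (ht : ∀ {q : SimplexCategory × SimplexCategory} (g : q ⟶ p) (hg : IsBoundary g),
      a.app g hg ≫ π = xiGrid.map g ≫ t) :
    ∃ F : toRelativeCat.obj ((xi.obj (grid.{u}.obj p)).sub (xiBoundary p)) ⟶ Z,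
      (∀ {q : SimplexCategory × SimplexCategory} (g : q ⟶ p) (hg : IsBoundary g)
        (c : NonemptyFiniteChains (NonemptyFiniteChains (grid.{u}.obj q))ᵒᵈ),
        F.functor.obj ⟨xiMap (grid.map g) c, hg.xiMap_mem c⟩ = a.val g hg c) ∧
      F ≫ π = toRelativeCat.map (subι _ _) ≫ t := by
  -- A retraction onto the face spanned by `c` is itself a boundary map when `c` is in the boundary,
  -- so the family can be evaluated on it directly.
  choose e he using fun c : NonemptyFiniteChains (NonemptyFiniteChains (grid.{u}.obj p))ᵒᵈ =>
    exists_isFaceRetraction c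
  have hb (c : xiBoundary.{u} p) : IsBoundary (e c.1) := (he c.1).isBoundary c.2
  let o (c : xiBoundary.{u} p) : Z := a.val (e c.1) (hb c) c.1
  -- The retraction chosen for `d` also fixes every `c ≤ d`, so both values, and the arrow between
  -- them, come from a single member of the family.
  have ho {c d : xiBoundary.{u} p} (h : c.1 ≤ d.1) : o c = a.val (e d.1) (hb d) c.1 :=
    a.val_congr_of_xiMap _ _ _ ((he d.1).xiMap_eq h) (he c.1) _
  let m {c d : xiBoundary.{u} p} (h : c.1 ≤ d.1) : o c ⟶ o d :=
    eqToHom (ho h) ≫ mapLE (P := xi.obj (grid.obj p)) (a.app (e d.1) (hb d)) h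
  let F : toRelativeCat.obj ((xi.obj (grid.{u}.obj p)).sub (xiBoundary p)) ⟶ Z :=
    { functor :=
        { obj := o
          map := fun h => m (leOfHom h)
          map_id := fun _ => Subsingleton.elim _ _
          map_comp := fun _ _ => Subsingleton.elim _ _ }
      map_weq := fun c d h hw =>
        Z.weq.comp_mem _ _ (weq_eqToHom _) ((a.app _ _).map_weq _ hw) }
  have hF (c : xiBoundary.{u} p) : π.functor.obj (o c) = onObj (P := xi.obj (grid.obj p)) t c.1 :=
    (congrArg (fun G : xiGrid.obj p ⟶ X => onObj (P := xi.obj (grid.obj p)) G c.1)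
      (ht (e c.1) (hb c))).trans (congrArg _ ((he c.1).xiMap_eq le_rfl))
  refine ⟨F, fun g hg c => a.val_congr_of_xiMap hg c _ rfl (he _) _, ?_⟩
  ext1
  refine CategoryTheory.Functor.ext hF fun c d h => ?_
  have h' : c.1 ≤ d.1 := leOfHom h
  change π.functor.map (m h') = eqToHom (hF c) ≫ mapLE (P := xi.obj (grid.obj p)) t h' ≫
    eqToHom (hF d).symm
  have h₁ := mapLE_eq (P := xi.obj (grid.obj p)) (ht (e d.1) (hb d)) h'
  have h₂ := mapLE_congr (P := xi.obj (grid.obj p)) t ((he d.1).xiMap_eq h')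
    ((he d.1).xiMap_eq le_rfl) ((xi.map (grid.map (e d.1))).toOrderHom.monotone h') h'
  have h₀ : π.functor.map (m h') = eqToHom (congrArg π.functor.obj (ho h')) ≫
      mapLE (P := xi.obj (grid.obj p)) (a.app (e d.1) (hb d) ≫ π) h' := by
    rw [π.functor.map_comp, eqToHom_map]
    rfl
  refine h₀.trans ((congrArg (eqToHom _ ≫ ·)
    (h₁.trans (congrArg (eqToHom _ ≫ · ≫ eqToHom _) h₂))).trans ?_)
  exact eqToHom_conj _ _ _ _ _ _ _ _

/-- If `π` lifts against the inclusion of the boundary, then a compatible family on the proper faces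
extends to a relative functor on `ξ([m] × [n])` over any given one. -/
lemma exists_lift [hZ : ∀ x y : Z, Subsingleton (x ⟶ y)] {X : RelativeCat.{u}} (π : Z ⟶ X)
    (t : xiGrid.obj p ⟶ X)
    (ht : ∀ {q : SimplexCategory × SimplexCategory} (g : q ⟶ p) (hg : IsBoundary g),
      a.app g hg ≫ π = xiGrid.map g ≫ t)
    (hπ : HasLiftingProperty (toRelativeCat.map (subι (xi.obj (grid.{u}.obj p)) (xiBoundary p))) π) :
    ∃ l : xiGrid.obj p ⟶ Z, l ≫ π = t ∧
      ∀ {q : SimplexCategory × SimplexCategory} (g : q ⟶ p) (hg : IsBoundary g),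
        xiGrid.map g ≫ l = a.app g hg := by
  obtain ⟨F, hF, hFt⟩ := a.exists_glue π t ht
  obtain ⟨⟨l, hl, hl'⟩⟩ := hπ.sq_hasLift ⟨hFt⟩
  refine ⟨l, hl', fun {q} g hg => ?_⟩
  ext1
  refine CategoryTheory.Functor.ext (fun c => ?_) fun _ _ _ => Subsingleton.elim _ _
  have h := congrArg (fun G : toRelativeCat.obj ((xi.obj (grid.{u}.obj p)).sub (xiBoundary p)) ⟶ Z =>
    G.functor.obj ⟨xiMap (grid.map g) c, hg.xiMap_mem c⟩) hl
  exact h.trans (hF g hg c)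

end BoundaryFamily

end Gluing

/-! ### Lifting against pushout-products of boundary inclusions -/

section PushoutProduct

open RelPoset RelativeCat SSet

variable {Z X : RelativeCat.{u}} {m n : ℕ}

lemma N_map_down {F : BiSSet.{u}} (a : F ⟶ N.{u}.obj Z) {q r : SimplexCategory × SimplexCategory}
    (f : r ⟶ q) (x : F.obj (op q)) :
    (a.app (op r) (F.map f.op x)).down = xiGrid.map f ≫ (a.app (op q) x).down :=
  congrArg ULift.down (NatTrans.naturality_apply a f.op x)

lemma N_hom_ext {F : BiSSet.{u}} {a b : F ⟶ N.{u}.obj Z}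
    (h : ∀ (q : SimplexCategory × SimplexCategory) (x : F.obj (op q)),
      (a.app (op q) x).down = (b.app (op q) x).down) : a = b := by
  ext q x
  exact ULift.ext _ _ (h q.unop x)

/-- The morphism from `Δ[m] □ Δ[n]` corresponding to an element of the nerve. -/
noncomputable def ofElement (l : xiGrid.obj (SimplexCategory.mk m, SimplexCategory.mk n) ⟶ Z) :
    (BiSSet.box.{u}.obj (stdSimplex.obj (SimplexCategory.mk m))).obj
      (stdSimplex.obj (SimplexCategory.mk n)) ⟶ N.{u}.obj Z where
  app q := ↾fun x => ULift.up (xiGrid.map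
    (Prod.mkHom (stdSimplex.objEquiv x.1) (stdSimplex.objEquiv x.2) :
      q.unop ⟶ (SimplexCategory.mk m, SimplexCategory.mk n)) ≫ l)
  naturality q r f := by
    ext x
    refine ULift.ext _ _ ?_
    exact (congrArg (· ≫ l) (xiGrid.map_comp f.unop
      (Prod.mkHom (stdSimplex.objEquiv x.1) (stdSimplex.objEquiv x.2) :
        q.unop ⟶ (SimplexCategory.mk m, SimplexCategory.mk n)))).trans (Category.assoc _ _ _)

/-- A morphism `Δ[m] □ Δ[n] ⟶ N Z` takes its values by restriction from its value at the
universal element. -/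
lemma app_eq (b : (BiSSet.box.{u}.obj (stdSimplex.obj (SimplexCategory.mk m))).obj
      (stdSimplex.obj (SimplexCategory.mk n)) ⟶ N.{u}.obj Z)
    {q : SimplexCategory × SimplexCategory}
    (g : q ⟶ (SimplexCategory.mk m, SimplexCategory.mk n)) :
    (b.app (op q) (stdSimplex.objEquiv.symm g.1, stdSimplex.objEquiv.symm g.2)).down =
      xiGrid.map g ≫ (b.app (op (SimplexCategory.mk m, SimplexCategory.mk n))
        (stdSimplex.objEquiv.symm (𝟙 _), stdSimplex.objEquiv.symm (𝟙 _))).down := by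
  refine Eq.trans ?_ (N_map_down b g _)
  exact congrArg (fun x => (b.app (op q) x).down)
    (Prod.ext (congrArg stdSimplex.objEquiv.symm (Category.comp_id g.1).symm)
      (congrArg stdSimplex.objEquiv.symm (Category.comp_id g.2).symm))

/-- A map from the pushout to the nerve is a pair of families, on the maps to `[m] × [n]` that are
not surjective in the first, respectively second, coordinate. The pushout square makes them agree on
the overlap, which yields a `BoundaryFamily`. -/
lemma hasLiftingProperty_pushoutProduct [hZ : ∀ x y : Z, Subsingleton (x ⟶ y)] (π : Z ⟶ X)
    (hπ : HasLiftingProperty (toRelativeCat.map (subι (xi.obj (grid.{u}.obj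
      (SimplexCategory.mk m, SimplexCategory.mk n))) (xiBoundary _))) π)
    (P : Functor.PushoutObjObj BiSSet.box.{u} (boundary.{u} m).ι (boundary.{u} n).ι) :
    HasLiftingProperty P.ι (N.{u}.map π) where
  sq_hasLift {a b} sq := by
    classical
    let p := (SimplexCategory.mk m, SimplexCategory.mk n)
    let fst {q : SimplexCategory × SimplexCategory} (g : q ⟶ p)
      (h : ¬ Function.Surjective g.1.toOrderHom) : xiGrid.obj q ⟶ Z :=
      ((P.inr ≫ a).app (op q) (⟨stdSimplex.objEquiv.symm g.1, h⟩,
        stdSimplex.objEquiv.symm g.2)).down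
    let snd {q : SimplexCategory × SimplexCategory} (g : q ⟶ p)
      (h : ¬ Function.Surjective g.2.toOrderHom) : xiGrid.obj q ⟶ Z :=
      ((P.inl ≫ a).app (op q) (stdSimplex.objEquiv.symm g.1,
        ⟨stdSimplex.objEquiv.symm g.2, h⟩)).down
    have fst_comp {q r : SimplexCategory × SimplexCategory} (f : r ⟶ q) (g : q ⟶ p) (h) (h') :
        fst (f ≫ g) h' = xiGrid.map f ≫ fst g h :=
      N_map_down (P.inr ≫ a) f (⟨stdSimplex.objEquiv.symm g.1, h⟩,
          stdSimplex.objEquiv.symm g.2)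
    have snd_comp {q r : SimplexCategory × SimplexCategory} (f : r ⟶ q) (g : q ⟶ p) (h) (h') :
        snd (f ≫ g) h' = xiGrid.map f ≫ snd g h :=
      N_map_down (P.inl ≫ a) f (stdSimplex.objEquiv.symm g.1,
          ⟨stdSimplex.objEquiv.symm g.2, h⟩)
    have fst_eq_snd {q : SimplexCategory × SimplexCategory} (g : q ⟶ p) (h) (h') :
        fst g h = snd g h' := by
      have := congrArg (· ≫ a) P.isPushout.w
      exact (congrArg (fun k : (BiSSet.box.obj (boundary.{u} m).toSSet).obj
        (boundary.{u} n).toSSet ⟶ N.obj Z => (k.app (op q)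
          (⟨stdSimplex.objEquiv.symm g.1, h⟩, ⟨stdSimplex.objEquiv.symm g.2, h'⟩)).down) this).symm
    let t : xiGrid.obj p ⟶ X := (b.app (op p)
        (stdSimplex.objEquiv.symm (𝟙 _), stdSimplex.objEquiv.symm (𝟙 _))).down
    have fst_π {q : SimplexCategory × SimplexCategory} (g : q ⟶ p) (h) :
        fst g h ≫ π = xiGrid.map g ≫ t := by
      have := (congrArg (P.inr ≫ ·) sq.w).trans (P.inr_ι_assoc b)
      refine Eq.trans ?_ (app_eq b g)
      exact congrArg (fun k : (BiSSet.box.obj (boundary.{u} m).toSSet).obj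
        (stdSimplex.obj (SimplexCategory.mk n)) ⟶ N.obj X => (k.app (op q)
          (⟨stdSimplex.objEquiv.symm g.1, h⟩, stdSimplex.objEquiv.symm g.2)).down) this
    have snd_π {q : SimplexCategory × SimplexCategory} (g : q ⟶ p) (h) :
        snd g h ≫ π = xiGrid.map g ≫ t := by
      have := (congrArg (P.inl ≫ ·) sq.w).trans (P.inl_ι_assoc b)
      refine Eq.trans ?_ (app_eq b g)
      exact congrArg (fun k : (BiSSet.box.obj (stdSimplex.obj (SimplexCategory.mk m))).obj
        (boundary.{u} n).toSSet ⟶ N.obj X => (k.app (op q)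
          (stdSimplex.objEquiv.symm g.1, ⟨stdSimplex.objEquiv.symm g.2, h⟩)).down) this
    let α : BoundaryFamily p Z :=
      { app := fun g hg =>
          if h : ¬ Function.Surjective g.1.toOrderHom then fst g h else snd g (hg.resolve_left h)
        app_comp := fun f g hg => by
          by_cases h : ¬ Function.Surjective g.1.toOrderHom
          · have h' : ¬ Function.Surjective (f ≫ g).1.toOrderHom :=
              fun h' => h (Function.Surjective.of_comp h')
            rw [dif_pos h, dif_pos h', fst_comp]
          · by_cases h' : ¬ Function.Surjective (f ≫ g).1.toOrderHom
            -- Here precomposition with `f` loses surjectivity in the first coordinate, so the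
            -- definition switches from `snd` to `fst`; both apply to `f ≫ g`, where they agree.
            · rw [dif_neg h, dif_pos h']
              have h₂ : ¬ Function.Surjective g.2.toOrderHom := Or.resolve_left hg h
              have h₂' : ¬ Function.Surjective (f ≫ g).2.toOrderHom :=
                fun h'' => h₂ (Function.Surjective.of_comp h'')
              exact (fst_eq_snd _ h' h₂').trans (snd_comp f g h₂ h₂')
            · rw [dif_neg h, dif_neg h', snd_comp] }
    have α_fst {q : SimplexCategory × SimplexCategory} (g : q ⟶ p) (h) :
        α.app g (Or.inl h) = fst g h := dif_pos h
    have α_snd {q : SimplexCategory × SimplexCategory} (g : q ⟶ p) (h) :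
        α.app g (Or.inr h) = snd g h := by
      by_cases h' : ¬ Function.Surjective g.1.toOrderHom
      · exact (dif_pos h').trans (fst_eq_snd _ _ _)
      · exact dif_neg h'
    obtain ⟨l, hl, hl'⟩ := α.exists_lift π t
      (fun g hg => by
        rcases hg with h | h
        · exact (congrArg (· ≫ π) (α_fst g h)).trans (fst_π g h)
        · exact (congrArg (· ≫ π) (α_snd g h)).trans (snd_π g h)) hπ
    refine ⟨⟨⟨ofElement l, ?_, ?_⟩⟩⟩
    · refine P.hom_ext ?_ ?_
      · rw [P.inl_ι_assoc]
        refine N_hom_ext fun q x => ?_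
        let g : q ⟶ p := Prod.mkHom (stdSimplex.objEquiv x.1) (stdSimplex.objEquiv x.2.1)
        exact (hl' g (Or.inr x.2.2)).trans (α_snd g x.2.2)
      · rw [P.inr_ι_assoc]
        refine N_hom_ext fun q x => ?_
        let g : q ⟶ p := Prod.mkHom (stdSimplex.objEquiv x.1.1) (stdSimplex.objEquiv x.2)
        exact (hl' g (Or.inl x.1.2)).trans (α_fst g x.1.2)
    · refine N_hom_ext fun q x => ?_
      let g : q ⟶ p := Prod.mkHom (stdSimplex.objEquiv x.1) (stdSimplex.objEquiv x.2)
      refine Eq.trans ?_ (app_eq b g).symm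
      exact (Category.assoc _ _ _).trans (congrArg (xiGrid.map g ≫ ·) hl)

end PushoutProduct

/-! ### Retracts and the conclusion -/

lemma IsDirectPoset.of_retract {C D : Type*} [Category C] [Category D] (hD : IsDirectPoset D)
    (s : C ⥤ D) (r : D ⥤ C) (h : s ⋙ r = 𝟭 C) : IsDirectPoset C := by
  have hobj (x : C) : r.obj (s.obj x) = x := Functor.congr_obj h x
  have hs : Function.Injective s.obj := fun x y e => by rw [← hobj x, ← hobj y, e]
  refine ⟨fun x y => ⟨fun f g => ?_⟩, fun x y f g => hs (hD.antisymm _ _ (s.map f) (s.map g)), ?_⟩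
  · have := hD.subsingleton_hom (s.obj x) (s.obj y)
    have hf := Functor.congr_hom h.symm f
    have hg := Functor.congr_hom h.symm g
    dsimp at hf hg
    rw [hf, hg, Subsingleton.elim (s.map f) (s.map g)]
  · exact Subrelation.wf (fun {x y} hxy => ⟨fun e => hxy.1 (hs e), hxy.2.map fun f => s.map f⟩)
      (InvImage.wf s.obj hD.wellFounded)

open RelativeCat RelPoset in
theorem mainTheorem9 (X : RelativeCat.{u}) (hX : HomotopicalAlgebra.IsCofibrant X) :
    IsDirectPoset X := by
  have hA (p : ℕ × ℕ) :=
    isDwyerSieve_xiBoundary.{u} (SimplexCategory.mk p.1, SimplexCategory.mk p.2)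
  let π := cellComplexπ X hA
  have hd : IsDirectPoset (cellComplex X hA) := isDirectPoset_cellComplex X hA fun p =>
    inferInstanceAs (WellFoundedLT (xiT.obj (xiI.obj (grid.{u}.obj
      (SimplexCategory.mk p.1, SimplexCategory.mk p.2)))))
  have hL := hasLiftingProperty_cellComplexπ X hA
  have hπ : generatingCofibrations.{u}.rlp π := by
    rintro _ _ _ ⟨_, _, f, ⟨p⟩, ⟨e⟩⟩
    -- The image of a class of maps under a functor is taken up to isomorphism of arrows; `e`
    -- removes this before passing to the adjoint side.
    rw [← HasLiftingProperty.iff_of_arrow_iso_left e, adjunctionKN.hasLiftingProperty_iff]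
    exact hasLiftingProperty_pushoutProduct _ (hL p) _
  have := hX.mem _ hπ
  -- A lift in this square is a section of `π`.
  have sq : CommSq (initial.to _) (initial.to X) π (𝟙 X) := ⟨Subsingleton.elim _ _⟩
  exact hd.of_retract sq.lift.functor π.functor (congrArg Hom.functor sq.fac_right)
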